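/- Let $(\beta_n)_{n\ge1}$ be the sequence \[ 0,\ -\tfrac12,0,\tfrac12,\ -\tfrac34,-\tfrac12,-\tfrac14,0,\tfrac14,\tfrac12,\tfrac34,\ -\tfrac78,\dots \] which, for $m=0,1,2,\dots$ successively, lists $j/2^m$ for all integers $j$ with $-2^m<j<2^m$ in increasing order (not necessarily in lowest terms). Let $a_{2n-1}=3$ and $a_{2n}=1$ for $n\ge1$, let $b_1=\beta_1$, and let $b_k=\beta_n$ whenever $n\ge1$ and $2n^2\le k<2(n+1)^2$. Then the Jacobi matrix $L$ with diagonal entries $b_1,b_2,\dots$ and off-diagonal entries $a_1,a_2,\dots$ defines a bounded self-adjoint operator on $\ell^2(\{1,2,3,\dots\})$. Let $\mu$ be its spectral measure at the first basis vector $\delta_1$, i.e. the measure on $\mathbb{R}$ with $\int f\,d\mu=\langle\delta_1,f(L)\delta_1\rangle$ for all continuous $f:\mathbb{R}\to\mathbb{R}$. The orthonormal polynomials $p_n$ of $\mu$ ($\deg p_n=n$, positive leading coefficient, $\int p_np_m\,d\mu=\delta_{nm}$) exist and have $a_n,b_n$ as recursion coefficients, \[ x\,p_n(x)=a_{n+1}p_{n+1}(x)+b_{n+1}p_n(x)+a_np_{n-1}(x)\quad(n\ge0,\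 p_{-1}=0), \] and the following hold. 1. $\operatorname{supp}\mu=[-5,-1]\cup[1,5]$. 2. For every $n\ge1$ there is a real $x_n$ with $|x_n-\beta_n|\le 2\cdot3^{-2n}$ and $p_{2(n+1)^2-1}(x_n)=0$. Moreover, the set $\{x\in(-1,1)\mid p_n(x)=0\text{ for some }n\}$ is dense in $[-1,1]$. -/

import Mathlib

open MeasureTheory Polynomial
open scoped ENNReal

namespace GapExample

/-- Enumeration of the pairs `(m, j)` with `m = 0, 1, 2, …` and, for each `m`, `j` running
increasingly through the integers with `-2 ^ m < j < 2 ^ m`. -/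
def dyadicIndex : ℕ → ℕ × ℤ
  | 0 => (0, 0)
  | n + 1 =>
    if (dyadicIndex n).2 + 1 < 2 ^ (dyadicIndex n).1 then
      ((dyadicIndex n).1, (dyadicIndex n).2 + 1)
    else
      ((dyadicIndex n).1 + 1, 1 - 2 ^ ((dyadicIndex n).1 + 1))

/-- The sequence `β₁, β₂, … = 0, -1/2, 0, 1/2, -3/4, -1/2, -1/4, 0, 1/4, 1/2, 3/4, -7/8, …`.
It is indexed from `1`; the value at `0` plays no role. -/
noncomputable def beta (n : ℕ) : ℝ :=
  ((dyadicIndex (n - 1)).2 : ℝ) / 2 ^ (dyadicIndex (n - 1)).1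

/-- Off-diagonal Jacobi parameters `a₁, a₂, … = 3, 1, 3, 1, …` (the value at `0` plays no role). -/
noncomputable def aSeq (n : ℕ) : ℝ := if Odd n then 3 else 1

/-- Diagonal Jacobi parameters: `b₁ = β₁`, and `b_k = β_n` when `2 n ^ 2 ≤ k < 2 (n + 1) ^ 2`,
`n ≥ 1` (the value at `0` plays no role). -/
noncomputable def bSeq (k : ℕ) : ℝ := if k ≤ 1 then beta 1 else beta (Nat.sqrt (k / 2))

theorem bSeq_one : bSeq 1 = beta 1 := by simp [bSeq]

theorem bSeq_block {n k : ℕ} (hn : 1 ≤ n) (h₁ : 2 * n ^ 2 ≤ k) (h₂ : k < 2 * (n + 1) ^ 2) :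
    bSeq k = beta n := by
  have h1 : 1 ≤ n ^ 2 := Nat.one_le_pow _ _ hn
  have hk : ¬ k ≤ 1 := by omega
  have hs : Nat.sqrt (k / 2) = n := by
    refine Nat.eq_sqrt'.2 ⟨?_, ?_⟩ |>.symm
    · omega
    · omega
  simp [bSeq, hk, hs]

/-- The Hilbert space `ℓ²` of square summable complex sequences; coordinate `k` here is the
coordinate number `k + 1` of the half-line `1, 2, 3, …`. -/
abbrev EllTwo : Type := lp (fun _ : ℕ => ℂ) 2

/-- The first basis vector of `ℓ²`. -/
noncomputable def firstVec : EllTwo := lp.single 2 0 (1 : ℂ)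

/-- The bounded operator `L` on `ℓ²` is given by the Jacobi matrix with diagonal `b₁, b₂, …` and
off-diagonal `a₁, a₂, …`. -/
def IsJacobiOperator (a b : ℕ → ℝ) (L : EllTwo →L[ℂ] EllTwo) : Prop :=
  ∀ u : EllTwo,
    L u 0 = (b 1 : ℂ) * u 0 + (a 1 : ℂ) * u 1 ∧
    ∀ k : ℕ, L u (k + 1) =
      (a (k + 1) : ℂ) * u k + (b (k + 2) : ℂ) * u (k + 1) + (a (k + 2) : ℂ) * u (k + 2)

/-- `μ` is the spectral measure of the bounded self-adjoint operator `T` at the vector `v`: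
`∫ f dμ = ⟨v, f(T) v⟩` for every continuous `f`. -/
def IsSpectralMeasure {H : Type*} [NormedAddCommGroup H] [InnerProductSpace ℂ H]
    [CompleteSpace H] (T : H →L[ℂ] H) (v : H) (μ : Measure ℝ) : Prop :=
  IsSelfAdjoint T ∧
    ∀ f : ℝ → ℝ, Continuous f →
      Integrable f μ ∧ ((∫ x, f x ∂μ : ℝ) : ℂ) = inner ℂ v (cfc f T v)

/-- `p₀, p₁, …` are the orthonormal polynomials of `μ`, with positive leading coefficients. -/
def IsOrthonormalPolynomials (μ : Measure ℝ) (p : ℕ → ℝ[X]) : Prop :=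
  (∀ n, (p n).natDegree = n ∧ 0 < (p n).leadingCoeff) ∧
    ∀ n m, Integrable (fun x => (p n).eval x * (p m).eval x) μ ∧
      ∫ x, (p n).eval x * (p m).eval x ∂μ = if n = m then 1 else 0

/-- `p` has the recursion coefficients `a₁, a₂, …`, `b₁, b₂, …`:
`x pₙ = a_{n+1} p_{n+1} + b_{n+1} pₙ + aₙ p_{n-1}` for `n ≥ 0`, where `p_{-1} = 0`. -/
def HasRecursion (a b : ℕ → ℝ) (p : ℕ → ℝ[X]) : Prop :=
  X * p 0 = C (a 1) * p 1 + C (b 1) * p 0 ∧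
    ∀ n : ℕ, X * p (n + 1) =
      C (a (n + 2)) * p (n + 2) + C (b (n + 2)) * p (n + 1) + C (a (n + 1)) * p n

end GapExample

/-!
On the block `2 n² ≤ k < 2 (n + 1)²` the matrix `L` is `βₙ + J`, where `J` is the 2-periodic matrix
with off-diagonal entries `3, 1, 3, 1, …`, whose bands are `[-4, -2]` and `[2, 4]`. Since every
point of `[-1, 1]` is a cluster point of `(βₙ)`, plane waves of `J` cut off to longer and longer
blocks give approximate eigenvectors of `L` for all energies in `[-5, -1] ∪ [1, 5]`. Conversely
`‖L‖ ≤ 5`, and `L = 3 S + W` with `S² = 1`, `‖S‖ ≤ 1` and `‖W‖ ≤ 2`, so `L - x` is invertible for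
`|x| < 1`.

The zeros of `p_N` are the eigenvalues of the truncation of `L` to the first `N` coordinates. For
`N = 2 (n + 1)² - 1` the truncation cuts a strong bond, of strength `3`, and so creates an edge
state, which decays by the factor `-1/3` with each pair of coordinates from the cut inwards. Its
energy is `βₙ` up to an error at the far end of the block, `2 n` pairs away; the truncation is
self-adjoint, so it has an eigenvalue that close to `βₙ`.
-/

open Filter Topology

namespace GapExample

section JacobiAction

variable {R M M' : Type*} [Semiring R] [AddCommMonoid M] [Module R M] [AddCommMonoid M']
  [Module R M']

/-- The Jacobi matrix with diagonal `b 1, b 2, …` and off-diagonal `a 1, a 2, …`, applied to a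
sequence of vectors. The same formula describes the action on coordinates, on a basis and on
orthogonal polynomials. -/
def jacobiAction (a b : ℕ → R) (u : ℕ → M) : ℕ → M
  | 0 => b 1 • u 0 + a 1 • u 1
  | n + 1 => a (n + 1) • u n + b (n + 2) • u (n + 1) + a (n + 2) • u (n + 2)

theorem jacobiAction_of_ne_zero (a b : ℕ → R) (u : ℕ → M) {n : ℕ} (hn : n ≠ 0) :
    jacobiAction a b u n = a n • u (n - 1) + b (n + 1) • u n + a (n + 1) • u (n + 1) := by
  obtain ⟨n, rfl⟩ := Nat.exists_eq_succ_of_ne_zero hn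
  rfl

theorem map_jacobiAction (φ : M →ₗ[R] M') (a b : ℕ → R) (u : ℕ → M) (n : ℕ) :
    φ (jacobiAction a b u n) = jacobiAction a b (fun k => φ (u k)) n := by
  cases n <;> simp only [jacobiAction, map_add, map_smul]

theorem jacobiAction_ite_comm (a b : ℕ → R) (z : M) (m n : ℕ) :
    jacobiAction a b (fun k => if k = m then z else 0) n =
      jacobiAction a b (fun k => if k = n then z else 0) m := by
  cases m <;> cases n <;> simp only [jacobiAction, smul_ite, smul_zero] <;> grind

end JacobiAction

theorem eq_of_jacobiAction_eq {𝕜 M : Type*} [Field 𝕜] [AddCommGroup M] [Module 𝕜 M]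
    {a b : ℕ → 𝕜} (ha : ∀ n, a (n + 1) ≠ 0) {u v : ℕ → M} (φ : M → M) {N : ℕ} (h₀ : u 0 = v 0)
    (hu : ∀ n < N, φ (u n) = jacobiAction a b u n)
    (hv : ∀ n < N, φ (v n) = jacobiAction a b v n) {n : ℕ} (hn : n ≤ N) : u n = v n := by
  induction n using Nat.strong_induction_on with
  | _ n ih =>
    match n with
    | 0 => exact h₀
    | 1 =>
      have h := hu 0 hn
      rw [h₀, hv 0 hn] at h
      simp only [jacobiAction, h₀, add_right_inj] at h
      exact (smul_right_injective M (ha 0) h).symm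
    | n + 2 =>
      have h := hu (n + 1) hn
      have h₁ : u (n + 1) = v (n + 1) := ih (n + 1) (by lia) (by lia)
      rw [h₁, hv (n + 1) hn] at h
      simp only [jacobiAction, ih n (by lia) (by lia), h₁, add_right_inj] at h
      exact (smul_right_injective M (ha (n + 1)) h).symm

theorem hasRecursion_iff {a b : ℕ → ℝ} {p : ℕ → ℝ[X]} :
    HasRecursion a b p ↔ ∀ n, X * p n = jacobiAction a b p n := by
  rw [← Nat.and_forall_add_one]
  simp only [HasRecursion, jacobiAction, smul_eq_C_mul]
  refine and_congr (by rw [add_comm]) (forall_congr' fun n => ?_)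
  rw [add_comm (C (a (n + 1)) * _), add_comm _ (C (a (n + 2)) * _), add_assoc]

theorem HasRecursion.aeval_apply {H : Type*} [NormedAddCommGroup H] [InnerProductSpace ℂ H]
    {a b : ℕ → ℝ} (ha : ∀ n, a (n + 1) ≠ 0) {p : ℕ → ℝ[X]} (hp : HasRecursion a b p)
    (hp₀ : p 0 = 1) {T : H →L[ℂ] H} {u : ℕ → H} {N : ℕ}
    (hu : ∀ n < N, T (u n) = jacobiAction a b u n) {n : ℕ} (hn : n ≤ N) :
    aeval T (p n) (u 0) = u n := by
  let evalAt : ℝ[X] →ₗ[ℝ] H :=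
    { toFun q := aeval T q (u 0)
      map_add' q r := by simp
      map_smul' c q := by simp }
  refine eq_of_jacobiAction_eq (u := fun k => evalAt (p k)) ha T (by simp [evalAt, hp₀])
    (fun k _ => ?_) hu hn
  have hX : T (evalAt (p k)) = evalAt (X * p k) := by simp [evalAt]
  exact (hX.trans (congrArg evalAt (hasRecursion_iff.1 hp k))).trans (map_jacobiAction ..)

section JacobiPolynomials

/-- The polynomials with recursion coefficients `a`, `b` that start with `1`. -/
noncomputable def jacobiPoly (a b : ℕ → ℝ) : ℕ → ℝ[X]
  | 0 => 1
  | 1 => C (a 1)⁻¹ * (X - C (b 1))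
  | n + 2 => C (a (n + 2))⁻¹ *
      ((X - C (b (n + 2))) * jacobiPoly a b (n + 1) - C (a (n + 1)) * jacobiPoly a b n)

variable {a b : ℕ → ℝ}

theorem jacobiPoly_hasRecursion (ha : ∀ n, a (n + 1) ≠ 0) :
    HasRecursion a b (jacobiPoly a b) := by
  have hC (n : ℕ) : C (a (n + 1)) * C (a (n + 1))⁻¹ = 1 := by
    rw [← C_mul, mul_inv_cancel₀ (ha n), C_1]
  constructor
  · rw [jacobiPoly, jacobiPoly, ← mul_assoc, hC]
    ring
  · intro n
    rw [jacobiPoly, ← mul_assoc, hC]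
    ring

theorem natDegree_jacobiPoly_and_leadingCoeff_pos (ha : ∀ n, 0 < a (n + 1)) (n : ℕ) :
    (jacobiPoly a b n).natDegree = n ∧ 0 < (jacobiPoly a b n).leadingCoeff := by
  induction n using Nat.twoStepInduction with
  | zero => simp [jacobiPoly]
  | one =>
    rw [jacobiPoly, natDegree_C_mul (inv_ne_zero (ha 0).ne'), leadingCoeff_mul]
    simp [ha 0]
  | more n ih₀ ih₁ =>
    have hne : jacobiPoly a b (n + 1) ≠ 0 := leadingCoeff_ne_zero.1 ih₁.2.ne'
    have hdeg : ((X - C (b (n + 2))) * jacobiPoly a b (n + 1)).natDegree = n + 2 := by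
      rw [natDegree_mul (X_sub_C_ne_zero _) hne, natDegree_X_sub_C, ih₁.1, add_comm]
    have hlt : (C (a (n + 1)) * jacobiPoly a b n).degree <
        ((X - C (b (n + 2))) * jacobiPoly a b (n + 1)).degree := by
      refine degree_lt_degree ?_
      rw [hdeg, natDegree_C_mul (ha n).ne', ih₀.1]
      lia
    rw [jacobiPoly, natDegree_C_mul (inv_ne_zero (ha _).ne'), leadingCoeff_mul,
      leadingCoeff_C, natDegree_eq_of_degree_eq (degree_sub_eq_left_of_degree_lt hlt), hdeg,
      leadingCoeff_sub_of_degree_lt hlt, leadingCoeff_mul, leadingCoeff_X_sub_C, one_mul]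
    exact ⟨rfl, mul_pos (inv_pos.2 (ha _)) ih₁.2⟩

end JacobiPolynomials

section Cyclic

variable {𝕜 H : Type*} [NontriviallyNormedField 𝕜] [NormedAddCommGroup H] [NormedSpace 𝕜 H]

/-- `v` is a cyclic vector of `T`: the vectors `q(T) v`, for polynomials `q`, are dense. -/
def IsCyclicVector (T : H →L[𝕜] H) (v : H) : Prop :=
  Dense (Set.range fun q : 𝕜[X] => aeval T q v)

theorem IsCyclicVector.eq_zero_of_commute {T S : H →L[𝕜] H} {v : H} (hv : IsCyclicVector T v)
    (hS : Commute S T) (hSv : S v = 0) : S = 0 := by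
  refine DFunLike.coe_injective (Continuous.ext_on hv S.continuous continuous_const ?_)
  rintro _ ⟨q, rfl⟩
  have hSq : Commute S (aeval T q) := Algebra.commute_of_mem_adjoin_singleton_of_commute
    (aeval_mem_adjoin_singleton 𝕜 T) hS
  simpa [hSv] using congrArg (fun A : H →L[𝕜] H => A v) hSq.eq

theorem isCyclicVector_of_dense_span {T : H →L[𝕜] H} {v : H} {s : Set H}
    (hs : ∀ w ∈ s, ∃ q : 𝕜[X], aeval T q v = w) (hdense : Dense (Submodule.span 𝕜 s : Set H)) :
    IsCyclicVector T v := by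
  let evalAt : 𝕜[X] →ₗ[𝕜] H :=
    { toFun q := aeval T q v
      map_add' q r := by simp
      map_smul' c q := by simp }
  exact hdense.mono (Submodule.span_le.2 hs : _ ≤ LinearMap.range evalAt)

end Cyclic

section SpectralMeasure

variable {H : Type*} [NormedAddCommGroup H] [InnerProductSpace ℂ H] [CompleteSpace H]
  {T : H →L[ℂ] H} {v : H} {μ : Measure ℝ}

theorem exists_mem_spectrum_abs_sub_mul_norm_le (hT : IsSelfAdjoint T) (c : ℝ) {u : H}
    (hu : u ≠ 0) : ∃ x ∈ spectrum ℝ T, |x - c| * ‖u‖ ≤ ‖T u - c • u‖ := by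
  have : Nontrivial H := ⟨u, 0, hu⟩
  obtain ⟨x, hx, hmin⟩ :=
    (ContinuousFunctionalCalculus.isCompact_spectrum (R := ℝ) T).exists_isMinOn
      (ContinuousFunctionalCalculus.spectrum_nonempty T hT) (f := fun y => (y - c) ^ 2)
      (by fun_prop)
  refine ⟨x, hx, abs_le_of_sq_le_sq' ?_ (norm_nonneg _) |>.2⟩
  set S : H →L[ℂ] H := T - algebraMap ℝ (H →L[ℂ] H) c
  have hS : IsSelfAdjoint S := hT.sub (.algebraMap _ (.all c))
  have hcfc : cfc (fun y : ℝ => (y - c) ^ 2) T = S * S := by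
    rw [show (fun y : ℝ => (y - c) ^ 2) = ((X - C c) ^ 2).eval by ext; simp,
      cfc_polynomial _ T hT, map_pow, map_sub, aeval_X, aeval_C, sq]
  have hSS : inner ℂ u ((S * S) u) = ((‖T u - c • u‖ ^ 2 : ℝ) : ℂ) := by
    refine (hS.isSymmetric u (S u)).symm.trans ((inner_self_eq_norm_sq_to_K _).trans ?_)
    simp [S, Algebra.algebraMap_eq_smul_one]
  have hxx : inner ℂ u (algebraMap ℝ (H →L[ℂ] H) ((x - c) ^ 2) u) =
      (((x - c) ^ 2 * ‖u‖ ^ 2 : ℝ) : ℂ) := by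
    simp [Algebra.algebraMap_eq_smul_one, inner_smul_right_eq_smul, inner_self_eq_norm_sq_to_K]
  have hpos := ((ContinuousLinearMap.le_def _ _).1
    (algebraMap_le_cfc (fun y : ℝ => (y - c) ^ 2) ((x - c) ^ 2) T hmin)).re_inner_nonneg_right u
  rw [hcfc, sub_apply, inner_sub_right, hSS, hxx, ← Complex.ofReal_sub, RCLike.re_to_complex,
    Complex.ofReal_re, sub_nonneg] at hpos
  rwa [mul_pow, sq_abs]

/-- The positive functional `f ↦ ⟪v, f(T) v⟫` on the continuous functions on the spectrum. -/
noncomputable def spectralFunctional (hT : IsSelfAdjoint T) (v : H) :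
    CompactlySupportedContinuousMap (spectrum ℝ T) ℝ →ₚ[ℝ] ℝ :=
  PositiveLinearMap.mk₀
    { toFun := fun f => (inner ℂ v (cfcHom (R := ℝ) hT f.toContinuousMap v)).re
      map_add' := fun f g => by
        have h : (f + g).toContinuousMap = f.toContinuousMap + g.toContinuousMap := rfl
        rw [h, map_add, add_apply, inner_add_right, Complex.add_re]
      map_smul' := fun c f => by
        have h : (c • f).toContinuousMap = c • f.toContinuousMap := rfl
        rw [h, map_smul, smul_apply, inner_smul_right_eq_smul]
        simp }
    fun f hf => ((ContinuousLinearMap.nonneg_iff_isPositive _).1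
      ((cfcHom_nonneg_iff hT).2 hf)).re_inner_nonneg_right v

theorem exists_isSpectralMeasure (hT : IsSelfAdjoint T) (v : H) :
    ∃ μ : Measure ℝ, IsSpectralMeasure T v μ := by
  have : CompactSpace (spectrum ℝ T) :=
    isCompact_iff_compactSpace.1 (ContinuousFunctionalCalculus.isCompact_spectrum T)
  refine ⟨(RealRMK.rieszMeasure (spectralFunctional hT v)).map Subtype.val, hT, fun f hf => ?_⟩
  let fOn : C(spectrum ℝ T, ℝ) := ⟨fun x => f x, by fun_prop⟩
  constructor
  · refine (integrable_map_measure hf.aestronglyMeasurable (by fun_prop)).2 ?_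
    exact fOn.continuous.integrable_of_hasCompactSupport (.of_compactSpace _)
  · have hreal : IsSelfAdjoint (cfcHom (R := ℝ) hT fOn) := cfcHom_predicate hT fOn
    rw [integral_map (by fun_prop) hf.aestronglyMeasurable, cfc_apply f T hT hf.continuousOn]
    refine Eq.trans (congrArg _ ?_) (hreal.isSymmetric.coe_re_inner_self_apply v)
    exact RealRMK.integral_rieszMeasure (spectralFunctional hT v) ⟨fOn, .of_compactSpace _⟩

namespace IsSpectralMeasure

theorem integral_mul_eq_inner (hμ : IsSpectralMeasure T v μ) {f g : ℝ → ℝ} (hf : Continuous f)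
    (hg : Continuous g) :
    ((∫ x, f x * g x ∂μ : ℝ) : ℂ) = inner ℂ (cfc f T v) (cfc g T v) := by
  refine (hμ.2 _ (by fun_prop : Continuous fun x => f x * g x)).2.trans ?_
  rw [cfc_mul f g T hf.continuousOn hg.continuousOn]
  exact ((IsSelfAdjoint.cfc (f := f) (a := T)).isSymmetric v (cfc g T v)).symm

theorem integral_eval_mul_eval (hμ : IsSpectralMeasure T v μ) (q r : ℝ[X]) :
    ((∫ x, q.eval x * r.eval x ∂μ : ℝ) : ℂ) = inner ℂ (aeval T q v) (aeval T r v) := by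
  rw [hμ.integral_mul_eq_inner q.continuous r.continuous, cfc_polynomial q T hμ.1,
    cfc_polynomial r T hμ.1]

theorem cfc_apply_eq_zero_iff (hμ : IsSpectralMeasure T v μ) {f : ℝ → ℝ} (hf : Continuous f) :
    cfc f T v = 0 ↔ f =ᵐ[μ] 0 := by
  have hsq := hμ.integral_mul_eq_inner hf hf
  rw [← inner_self_eq_zero (𝕜 := ℂ), ← hsq, Complex.ofReal_eq_zero,
    integral_eq_zero_iff_of_nonneg (fun x => mul_self_nonneg (f x)) (hμ.2 _ (hf.mul hf)).1]
  simp [EventuallyEq]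

theorem support_subset_spectrum (hμ : IsSpectralMeasure T v μ) : μ.support ⊆ spectrum ℝ T := by
  intro x hxμ
  by_contra hx
  obtain ⟨f, hf₀, hf₁, -⟩ := exists_continuous_zero_one_of_isClosed
    (ContinuousFunctionalCalculus.isCompact_spectrum (R := ℝ) T).isClosed isClosed_singleton
    (Set.disjoint_singleton_right.2 hx)
  have hcfc : cfc f T = 0 := (cfc_congr hf₀).trans (cfc_zero ℝ T)
  have hae : f =ᵐ[μ] 0 := (hμ.cfc_apply_eq_zero_iff f.continuous).1 (by simp [hcfc])
  refine Measure.notMem_support_iff_exists.2 ⟨{y | f y ≠ 0}, ?_, hae⟩ hxμ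
  exact f.continuous.continuousAt.eventually_ne (by simp [hf₁ rfl])

theorem support_eq_spectrum (hμ : IsSpectralMeasure T v μ) (hv : IsCyclicVector T v) :
    μ.support = spectrum ℝ T := by
  refine hμ.support_subset_spectrum.antisymm fun x hx => ?_
  by_contra hxμ
  obtain ⟨f, hf₀, hf₁, -⟩ := exists_continuous_zero_one_of_isClosed Measure.isClosed_support
    isClosed_singleton (Set.disjoint_singleton_right.2 hxμ)
  have hae : f =ᵐ[μ] 0 := by filter_upwards [Measure.support_mem_ae] with y hy using hf₀ hy
  have hcomm : Commute (cfc f T) T := by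
    simpa only [cfc_id ℝ T hμ.1] using cfc_commute_cfc f id T
  have hcfc : cfc f T = 0 :=
    hv.eq_zero_of_commute hcomm ((hμ.cfc_apply_eq_zero_iff f.continuous).2 hae)
  have hmem : f x ∈ spectrum ℝ (cfc f T) :=
    (cfc_map_spectrum f T hμ.1 f.continuous.continuousOn).symm ▸ Set.mem_image_of_mem f hx
  simp [hcfc, hf₁ rfl, spectrum.mem_iff] at hmem

end IsSpectralMeasure

end SpectralMeasure

section OrthonormalPolynomials

section Functional

variable {𝕜 : Type*} [Field 𝕜] {I : 𝕜[X] →ₗ[𝕜] 𝕜} {p q : Polynomial.Sequence 𝕜}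

theorem apply_mul_eq_zero_of_degree_lt (hp : ∀ n m, I (p n * p m) = if n = m then 1 else 0)
    {n : ℕ} {r : 𝕜[X]} (hr : r.degree < n) : I (p n * r) = 0 := by
  have hunit (k : ℕ) : IsUnit (p k).leadingCoeff := (leadingCoeff_ne_zero.2 (p.ne_zero k)).isUnit
  rw [← mem_degreeLT, ← p.span_degreeLT fun k _ => hunit k] at hr
  induction hr using Submodule.span_induction with
  | mem _ h =>
    obtain ⟨k, hk, rfl⟩ := h
    rw [hp, if_neg (Set.mem_Iio.1 hk).ne']
  | zero => simp
  | add _ _ _ _ h₁ h₂ => rw [mul_add, map_add, h₁, h₂, add_zero]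
  | smul c _ _ h => rw [mul_smul_comm, map_smul, h, smul_zero]

theorem apply_mul_mul_leadingCoeff (hp : ∀ n m, I (p n * p m) = if n = m then 1 else 0)
    {n : ℕ} {r : 𝕜[X]} (hr : r.degree = n) :
    I (p n * r) * (p n).leadingCoeff = r.leadingCoeff := by
  have hlead : (p n).leadingCoeff ≠ 0 := leadingCoeff_ne_zero.2 (p.ne_zero n)
  set c := r.leadingCoeff / (p n).leadingCoeff
  have hr₀ : r ≠ 0 := degree_ne_bot.1 (by simp [hr])
  have hcr : r.leadingCoeff = (c • p n).leadingCoeff := by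
    rw [smul_eq_C_mul, leadingCoeff_mul, leadingCoeff_C, div_mul_cancel₀ _ hlead]
  have hc : c ≠ 0 := div_ne_zero (leadingCoeff_ne_zero.2 hr₀) hlead
  have hlt : (r - c • p n).degree < n :=
    hr ▸ degree_sub_lt_left (by rw [hr, smul_eq_C_mul, degree_C_mul hc, p.degree_eq]) hr₀ hcr
  have h := apply_mul_eq_zero_of_degree_lt hp hlt
  rw [mul_sub, map_sub, mul_smul_comm, map_smul, hp, if_pos rfl, sub_eq_zero] at h
  rw [h, smul_eq_mul, mul_one, div_mul_cancel₀ _ hlead]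

theorem eq_of_leadingCoeff_eq (hp : ∀ n m, I (p n * p m) = if n = m then 1 else 0)
    (hq : ∀ n m, I (q n * q m) = if n = m then 1 else 0) {n : ℕ}
    (h : (p n).leadingCoeff = (q n).leadingCoeff) : p n = q n := by
  by_contra hne
  set r := p n - q n
  have hr : r ≠ 0 := sub_ne_zero.2 hne
  have hdeg : r.natDegree < n := by
    have := degree_sub_lt_left (by simp) (p.ne_zero n) h
    rwa [p.degree_eq, degree_eq_natDegree hr, Nat.cast_lt] at this
  have hkr : I (p r.natDegree * r) = 0 := by
    have hlt : (p r.natDegree).degree < n := by simpa using hdeg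
    rw [mul_sub, map_sub, mul_comm _ (p n), mul_comm _ (q n),
      apply_mul_eq_zero_of_degree_lt hp hlt, apply_mul_eq_zero_of_degree_lt hq hlt, sub_zero]
  have := apply_mul_mul_leadingCoeff hp (degree_eq_natDegree hr)
  rw [hkr, zero_mul, eq_comm, leadingCoeff_eq_zero] at this
  exact hr this

end Functional

namespace IsOrthonormalPolynomials

variable {μ : Measure ℝ} {p q : ℕ → ℝ[X]}

/-- Orthonormal polynomials as a sequence of polynomials with one member in each degree. -/
def toSequence (hp : IsOrthonormalPolynomials μ p) : Polynomial.Sequence ℝ where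
  elems' := p
  degree_eq' n := by
    rw [degree_eq_natDegree (leadingCoeff_ne_zero.1 (hp.1 n).2.ne'), (hp.1 n).1]

theorem integrable_eval (hp : IsOrthonormalPolynomials μ p) (r : ℝ[X]) :
    Integrable (fun x => r.eval x) μ := by
  have hmem : r ∈ Submodule.span ℝ (Set.range p) := by
    have h := hp.toSequence.span fun n => (hp.1 n).2.ne'.isUnit
    exact h.symm ▸ Submodule.mem_top
  induction hmem using Submodule.span_induction with
  | mem _ h =>
    obtain ⟨n, rfl⟩ := h
    obtain ⟨c, hc⟩ : ∃ c, p 0 = C c := ⟨_, eq_C_of_natDegree_eq_zero (hp.1 0).1⟩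
    have hc₀ : c ≠ 0 := by
      have := (hp.1 0).2.ne'
      simpa [hc] using this
    have := (hp.2 n 0).1.mul_const c⁻¹
    simpa [hc, hc₀] using this
  | zero => simp
  | add _ _ _ _ h₁ h₂ => simpa only [eval_add] using! h₁.add h₂
  | smul c _ _ h => simpa using h.const_mul c

/-- The functional `q ↦ ∫ q dμ` on polynomials. -/
noncomputable def integralFunctional (hp : IsOrthonormalPolynomials μ p) : ℝ[X] →ₗ[ℝ] ℝ where
  toFun r := ∫ x, r.eval x ∂μ
  map_add' r s := by simp [integral_add (hp.integrable_eval r) (hp.integrable_eval s)]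
  map_smul' c r := by simp [integral_const_mul]

theorem integralFunctional_mul (hp : IsOrthonormalPolynomials μ p)
    (hq : IsOrthonormalPolynomials μ q) (n m : ℕ) :
    hp.integralFunctional (hq.toSequence n * hq.toSequence m) = if n = m then 1 else 0 := by
  rw [← (hq.2 n m).2]
  exact integral_congr_ae (.of_forall fun x => eval_mul)

theorem eq (hp : IsOrthonormalPolynomials μ p) (hq : IsOrthonormalPolynomials μ q) : p = q := by
  have hpI := hp.integralFunctional_mul hp
  have hqI := hp.integralFunctional_mul hq
  refine funext fun n => eq_of_leadingCoeff_eq hpI hqI ?_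
  have h₁ := apply_mul_mul_leadingCoeff hpI (hq.toSequence.degree_eq n)
  have h₂ := apply_mul_mul_leadingCoeff hqI (hp.toSequence.degree_eq n)
  rw [mul_comm (hq.toSequence n)] at h₂
  have hpos₁ : 0 < (hp.toSequence n).leadingCoeff := (hp.1 n).2
  have hpos₂ : 0 < (hq.toSequence n).leadingCoeff := (hq.1 n).2
  refine (sq_eq_sq₀ hpos₁.le hpos₂.le).1 ?_
  linear_combination (hq.toSequence n).leadingCoeff * h₁ - (hp.toSequence n).leadingCoeff * h₂

end IsOrthonormalPolynomials

end OrthonormalPolynomials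

section JacobiSystem

variable {H : Type*} [NormedAddCommGroup H] [InnerProductSpace ℂ H]

/-- `T` acts on the orthonormal sequence `e` by the Jacobi matrix with diagonal `b 1, b 2, …` and
off-diagonal `a 1, a 2, …`. -/
structure IsJacobiSystem (a b : ℕ → ℝ) (T : H →L[ℂ] H) (e : ℕ → H) : Prop where
  orthonormal : Orthonormal ℂ e
  apply_eq : ∀ n, T (e n) = jacobiAction a b e n

variable {a b : ℕ → ℝ} {T : H →L[ℂ] H} {e : ℕ → H}

theorem IsJacobiSystem.aeval_jacobiPoly (he : IsJacobiSystem a b T e)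
    (ha : ∀ n, a (n + 1) ≠ 0) (n : ℕ) : aeval T (jacobiPoly a b n) (e 0) = e n :=
  (jacobiPoly_hasRecursion ha).aeval_apply ha rfl (fun k _ => he.apply_eq k) le_rfl

theorem IsJacobiSystem.isCyclicVector (he : IsJacobiSystem a b T e)
    (ha : ∀ n, a (n + 1) ≠ 0) (hdense : Dense (Submodule.span ℂ (Set.range e) : Set H)) :
    IsCyclicVector T (e 0) := by
  refine isCyclicVector_of_dense_span (Set.forall_mem_range.2 fun n => ?_) hdense
  exact ⟨(jacobiPoly a b n).map (algebraMap ℝ ℂ), by simp [he.aeval_jacobiPoly ha]⟩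

theorem IsJacobiSystem.isOrthonormalPolynomials [CompleteSpace H] (he : IsJacobiSystem a b T e)
    (ha : ∀ n, 0 < a (n + 1)) {μ : Measure ℝ} (hμ : IsSpectralMeasure T (e 0) μ) :
    IsOrthonormalPolynomials μ (jacobiPoly a b) := by
  refine ⟨natDegree_jacobiPoly_and_leadingCoeff_pos ha, fun n m => ⟨?_, ?_⟩⟩
  · exact (hμ.2 _ ((jacobiPoly a b n).continuous.mul (jacobiPoly a b m).continuous)).1
  · have h := hμ.integral_eval_mul_eval (jacobiPoly a b n) (jacobiPoly a b m)
    rw [he.aeval_jacobiPoly fun k => (ha k).ne', he.aeval_jacobiPoly fun k => (ha k).ne',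
      orthonormal_iff_ite.1 he.orthonormal] at h
    rw [← Complex.ofReal_inj, h]
    split_ifs <;> simp

end JacobiSystem

section Compression

variable {H : Type*} [NormedAddCommGroup H] [InnerProductSpace ℂ H]

/-- The compression of `T` to the subspace `K`, i.e. the operator `P T` on `K`, where `P` is the
orthogonal projection onto `K`. -/
noncomputable def compression (T : H →L[ℂ] H) (K : Submodule ℂ H) [K.HasOrthogonalProjection] :
    K →L[ℂ] K :=
  K.orthogonalProjectionOnto ∘L T ∘L K.subtypeL

theorem compression_apply (T : H →L[ℂ] H) (K : Submodule ℂ H) [K.HasOrthogonalProjection]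
    (u : K) : compression T K u = K.orthogonalProjectionOnto (T u) := rfl

theorem isSelfAdjoint_compression [CompleteSpace H] {T : H →L[ℂ] H} (hT : IsSelfAdjoint T)
    (K : Submodule ℂ H) [CompleteSpace K] : IsSelfAdjoint (compression T K) := by
  rw [compression, ← K.adjoint_subtypeL]
  exact hT.adjoint_conj K.subtypeL

/-- The span of the first `N` members of a sequence of vectors. -/
def initialSpan (e : ℕ → H) (N : ℕ) : Submodule ℂ H :=
  Submodule.span ℂ (e '' Set.Iio N)

instance (e : ℕ → H) (N : ℕ) : FiniteDimensional ℂ (initialSpan e N) :=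
  FiniteDimensional.span_of_finite ℂ ((Set.finite_Iio N).image e)

theorem mem_initialSpan (e : ℕ → H) {n N : ℕ} (hn : n < N) : e n ∈ initialSpan e N :=
  Submodule.subset_span ⟨n, hn, rfl⟩

theorem orthogonalProjectionOnto_initialSpan_eq_zero {e : ℕ → H} (he : Orthonormal ℂ e)
    {n N : ℕ} (hn : N ≤ n) : (initialSpan e N).orthogonalProjectionOnto (e n) = 0 := by
  have horth : Submodule.span ℂ {e n} ⟂ initialSpan e N := Submodule.isOrtho_span.2 <| by
    rintro _ rfl _ ⟨k, hk, rfl⟩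
    exact he.2 (hk.trans_le hn).ne'
  exact Submodule.orthogonalProjectionOnto_eq_zero_iff.2
    (horth (Submodule.mem_span_singleton_self _))

namespace IsJacobiSystem

variable {a b : ℕ → ℝ} {T : H →L[ℂ] H} {e : ℕ → H}

theorem eval_jacobiPoly_eq_zero_of_mem_spectrum (he : IsJacobiSystem a b T e)
    (ha : ∀ n, a (n + 1) ≠ 0) {N : ℕ} {x : ℝ}
    (hx : x ∈ spectrum ℝ (compression T (initialSpan e N))) : (jacobiPoly a b N).eval x = 0 := by
  set P := (initialSpan e N).orthogonalProjectionOnto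
  set S := compression T (initialSpan e N)
  have hPe {n : ℕ} (hn : n < N) : (P (e n) : H) = e n :=
    Submodule.starProjection_eq_self_iff.2 (mem_initialSpan e hn)
  have hact (n : ℕ) (hn : n < N) : S (P (e n)) = jacobiAction a b (fun k => P (e k)) n := by
    rw [compression_apply, hPe hn, he.apply_eq]
    exact map_jacobiAction (P.toLinearMap.restrictScalars ℝ) a b e n
  have haeval {n : ℕ} (hn : n ≤ N) : aeval S (jacobiPoly a b n) (P (e 0)) = P (e n) :=
    (jacobiPoly_hasRecursion ha).aeval_apply ha rfl hact hn
  have hcyclic : IsCyclicVector S (P (e 0)) := by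
    refine isCyclicVector_of_dense_span (s := (↑) ⁻¹' (e '' Set.Iio N)) ?_ ?_
    · rintro w ⟨n, hn, hw⟩
      have hwP : P (e n) = w := Subtype.ext ((hPe hn).trans hw)
      exact ⟨(jacobiPoly a b n).map (algebraMap ℝ ℂ), by simp [haeval hn.le, hwP]⟩
    · rw [initialSpan, Submodule.span_span_coe_preimage]
      exact dense_univ
  have hzero : aeval S (jacobiPoly a b N) = 0 := by
    refine hcyclic.eq_zero_of_commute (Algebra.commute_of_mem_adjoin_singleton_of_commute
      (aeval_mem_adjoin_singleton ℝ S) (.refl S)).symm ?_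
    rw [haeval le_rfl, orthogonalProjectionOnto_initialSpan_eq_zero he.orthonormal le_rfl]
  have hmem := spectrum.subset_polynomial_aeval S (jacobiPoly a b N) ⟨x, hx, rfl⟩
  rw [hzero, spectrum.mem_iff, sub_zero] at hmem
  by_contra h
  exact hmem ((IsUnit.mk0 _ h).map _)

theorem exists_eval_jacobiPoly_eq_zero [CompleteSpace H] (he : IsJacobiSystem a b T e)
    (ha : ∀ n, a (n + 1) ≠ 0) (hT : IsSelfAdjoint T) (c : ℝ) {N : ℕ} {u : H}
    (hu : u ∈ initialSpan e N) (hu₀ : u ≠ 0) :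
    ∃ x, (jacobiPoly a b N).eval x = 0 ∧ |x - c| * ‖u‖ ≤
      ‖(initialSpan e N).orthogonalProjectionOnto (T u - c • u)‖ := by
  have : CompleteSpace (initialSpan e N) := FiniteDimensional.complete ℂ _
  let w : initialSpan e N := ⟨u, hu⟩
  obtain ⟨x, hx, hle⟩ := exists_mem_spectrum_abs_sub_mul_norm_le
    (isSelfAdjoint_compression hT _) c (u := w) (Subtype.coe_ne_coe.1 hu₀)
  refine ⟨x, he.eval_jacobiPoly_eq_zero_of_mem_spectrum ha hx, hle.trans_eq ?_⟩
  have hPw : (initialSpan e N).orthogonalProjectionOnto (c • u) = c • w :=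
    Submodule.orthogonalProjectionOnto_mem_subspace_eq_self (c • w)
  rw [map_sub, hPw, compression_apply]

end IsJacobiSystem

end Compression

theorem aSeq_two_mul (k : ℕ) : aSeq (2 * k) = 1 := by simp [aSeq]

theorem aSeq_two_mul_add_one (k : ℕ) : aSeq (2 * k + 1) = 3 := by simp [aSeq]

theorem aSeq_pos (n : ℕ) : 0 < aSeq n := by
  rw [aSeq]
  split_ifs <;> norm_num

section EdgeState

variable {H : Type*} [NormedAddCommGroup H] [InnerProductSpace ℂ H]

theorem norm_le_norm_sum_smul_of_orthonormal {𝕜 E ι : Type*} [RCLike 𝕜] [NormedAddCommGroup E]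
    [InnerProductSpace 𝕜 E] {v : ι → E} (hv : Orthonormal 𝕜 v) (c : ι → 𝕜) {s : Finset ι} {i : ι}
    (hi : i ∈ s) : ‖c i‖ ≤ ‖∑ k ∈ s, c k • v k‖ := by
  calc ‖c i‖ = ‖inner 𝕜 (v i) (∑ k ∈ s, c k • v k)‖ := by rw [hv.inner_right_sum c hi]
    _ ≤ ‖v i‖ * ‖∑ k ∈ s, c k • v k‖ := norm_inner_le_norm _ _
    _ = ‖∑ k ∈ s, c k • v k‖ := by rw [hv.1 i, one_mul]

/-- The approximate eigenvector for the value `beta n`: it lives on the block on which the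
diagonal is constantly `beta n`, and decays exponentially away from the right end of that block. -/
noncomputable def edgeState (e : ℕ → H) (n : ℕ) : H :=
  ∑ k ∈ Finset.Ico (n ^ 2) ((n + 1) ^ 2), (-3 : ℝ) ^ k • e (2 * k)

theorem edgeState_mem_initialSpan (e : ℕ → H) (n : ℕ) :
    edgeState e n ∈ initialSpan e (2 * (n + 1) ^ 2 - 1) := by
  refine sum_mem fun k hk => Submodule.smul_of_tower_mem _ _ (mem_initialSpan e ?_)
  have := (Finset.mem_Ico.1 hk).2
  lia

theorem three_pow_le_norm_edgeState {e : ℕ → H} (he : Orthonormal ℂ e) (n : ℕ) :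
    3 ^ (n ^ 2 + 2 * n) ≤ ‖edgeState e n‖ := by
  have hlast : n ^ 2 + 2 * n ∈ Finset.Ico (n ^ 2) ((n + 1) ^ 2) :=
    Finset.mem_Ico.2 ⟨by lia, by lia⟩
  simpa [edgeState, ← Complex.coe_smul] using norm_le_norm_sum_smul_of_orthonormal
    (he.comp _ (mul_right_injective₀ two_ne_zero)) (fun k => (-3 : ℂ) ^ k) hlast

namespace IsJacobiSystem

variable {T : H →L[ℂ] H} {e : ℕ → H}

theorem apply_edgeState_sub (he : IsJacobiSystem aSeq bSeq T e) {n : ℕ} (hn : 1 ≤ n) :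
    T (edgeState e n) - beta n • edgeState e n =
      (-3 : ℝ) ^ n ^ 2 • e (2 * n ^ 2 - 1) -
        (-3 : ℝ) ^ (n + 1) ^ 2 • e (2 * (n + 1) ^ 2 - 1) := by
  have hterm : ∀ k ∈ Finset.Ico (n ^ 2) ((n + 1) ^ 2),
      T ((-3 : ℝ) ^ k • e (2 * k)) - beta n • (-3 : ℝ) ^ k • e (2 * k) =
        -((-3 : ℝ) ^ (k + 1) • e (2 * (k + 1) - 1) - (-3 : ℝ) ^ k • e (2 * k - 1)) := by
    intro k hk
    rw [Finset.mem_Ico] at hk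
    have hk₀ : 2 * k ≠ 0 := by have := Nat.pow_pos (n := 2) hn; lia
    have hT : T (e (2 * k)) = e (2 * k - 1) + beta n • e (2 * k) + (3 : ℝ) • e (2 * k + 1) := by
      rw [he.apply_eq, jacobiAction_of_ne_zero _ _ _ hk₀, aSeq_two_mul, aSeq_two_mul_add_one,
        bSeq_block hn (by lia) (by lia), one_smul]
    rw [ContinuousLinearMap.map_smul_of_tower, hT, show 2 * (k + 1) - 1 = 2 * k + 1 by lia,
      pow_succ]
    module
  rw [edgeState, map_sum, Finset.smul_sum, ← Finset.sum_sub_distrib, Finset.sum_congr rfl hterm,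
    Finset.sum_neg_distrib,
    Finset.sum_Ico_sub (fun k => (-3 : ℝ) ^ k • e (2 * k - 1)) (by gcongr; lia), neg_sub]

theorem exists_eval_jacobiPoly_eq_zero_near_beta [CompleteSpace H]
    (he : IsJacobiSystem aSeq bSeq T e) (hT : IsSelfAdjoint T) {n : ℕ} (hn : 1 ≤ n) :
    ∃ x, |x - beta n| ≤ (3 ^ (2 * n))⁻¹ ∧
      (jacobiPoly aSeq bSeq (2 * (n + 1) ^ 2 - 1)).eval x = 0 := by
  have hnorm := three_pow_le_norm_edgeState he.orthonormal n
  have hpos : 0 < ‖edgeState e n‖ := (by positivity : (0 : ℝ) < _).trans_le hnorm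
  obtain ⟨x, hx, hle⟩ := he.exists_eval_jacobiPoly_eq_zero (fun k => (aSeq_pos _).ne') hT (beta n)
    (edgeState_mem_initialSpan e n) (norm_pos_iff.1 hpos)
  refine ⟨x, ?_, hx⟩
  set P := (initialSpan e (2 * (n + 1) ^ 2 - 1)).orthogonalProjectionOnto
  -- `P` annihilates the large boundary term, at the right end of the block.
  have hproj : ‖P (T (edgeState e n) - beta n • edgeState e n)‖ ≤ 3 ^ n ^ 2 := by
    rw [he.apply_edgeState_sub hn, map_sub, ContinuousLinearMap.map_smul_of_tower,
      ContinuousLinearMap.map_smul_of_tower,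
      orthogonalProjectionOnto_initialSpan_eq_zero he.orthonormal le_rfl, smul_zero, sub_zero,
      norm_smul]
    have hP : ‖P (e (2 * n ^ 2 - 1))‖ ≤ 1 :=
      (Submodule.norm_orthogonalProjectionOnto_apply_le _ _).trans_eq (he.orthonormal.1 _)
    simpa using hP
  rw [← mul_le_mul_iff_left₀ (by positivity : (0 : ℝ) < 3 ^ (n ^ 2 + 2 * n))]
  calc |x - beta n| * 3 ^ (n ^ 2 + 2 * n) ≤ |x - beta n| * ‖edgeState e n‖ := by gcongr
    _ ≤ 3 ^ n ^ 2 := hle.trans hproj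
    _ = (3 ^ (2 * n))⁻¹ * 3 ^ (n ^ 2 + 2 * n) := by rw [pow_add]; field_simp

end IsJacobiSystem

end EdgeState

section PlaneWave

theorem exists_norm_eq_one_norm_one_add_three_mul_eq {t : ℝ} (h₂ : 2 ≤ t) (h₄ : t ≤ 4) :
    ∃ z : ℂ, ‖z‖ = 1 ∧ ‖1 + 3 * z‖ = t := by
  set θ := Real.arccos ((t ^ 2 - 10) / 6)
  have hcos : Real.cos θ = (t ^ 2 - 10) / 6 := Real.cos_arccos (by nlinarith) (by nlinarith)
  refine ⟨Complex.exp (θ * Complex.I), Complex.norm_exp_ofReal_mul_I θ, ?_⟩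
  rw [← sq_eq_sq₀ (norm_nonneg _) (by linarith), Complex.sq_norm, Complex.normSq_apply]
  simp only [Complex.add_re, Complex.one_re, Complex.mul_re, Complex.re_ofNat, Complex.im_ofNat,
    Complex.exp_ofReal_mul_I_re, Complex.exp_ofReal_mul_I_im, Complex.add_im, Complex.one_im,
    Complex.mul_im]
  linear_combination 6 * hcos + 9 * Real.sin_sq_add_cos_sq θ

/-- The phase `z` belongs to the energy `τ` if `τ ^ 2 = |1 + 3 z| ^ 2`; this is the dispersion
relation of the 2-periodic Jacobi matrix with off-diagonal `3, 1, 3, 1, …` and zero diagonal. -/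
structure IsBlochPhase (τ : ℝ) (z : ℂ) : Prop where
  norm_eq_one : ‖z‖ = 1
  norm_one_add_three_mul : ‖1 + 3 * z‖ = |τ|

theorem IsBlochPhase.mul_eq {τ : ℝ} {z : ℂ} (hz : IsBlochPhase τ z) :
    (1 + 3 * z) * (z + 3) = τ ^ 2 * z := by
  have hconj : z * starRingEnd ℂ z = 1 := by simp [Complex.mul_conj', hz.norm_eq_one]
  have hτ : (1 + 3 * z) * (1 + 3 * starRingEnd ℂ z) = τ ^ 2 := by
    simpa [hz.norm_one_add_three_mul, ← Complex.ofReal_pow, Complex.conj_ofNat] using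
      Complex.mul_conj' (1 + 3 * z)
  linear_combination z * hτ - 3 * (1 + 3 * z) * hconj

variable {H : Type*} [NormedAddCommGroup H] [InnerProductSpace ℂ H]

/-- The part of a plane wave with energy `τ` and phase `z` that is supported on the block on which
the diagonal is constantly `beta n`. -/
noncomputable def planeWave (e : ℕ → H) (τ : ℝ) (z : ℂ) (n : ℕ) : H :=
  ∑ i ∈ Finset.Ico (n ^ 2) (n ^ 2 + 2 * n),
    z ^ (i + 1) • ((τ : ℂ) • e (2 * i + 1) + (1 + 3 * z) • e (2 * i + 2))

/-- The error made by truncating a plane wave between the positions `2 i` and `2 i + 1`. -/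
noncomputable def waveBoundary (e : ℕ → H) (τ : ℝ) (z : ℂ) (i : ℕ) : H :=
  (3 * z ^ i) • (((τ : ℂ) * z) • e (2 * i) - (1 + 3 * z) • e (2 * i + 1))

variable {τ : ℝ} {z : ℂ} {e : ℕ → H}

theorem norm_waveBoundary_le (he : Orthonormal ℂ e) (hz : IsBlochPhase τ z) (i : ℕ) :
    ‖waveBoundary e τ z i‖ ≤ 6 * |τ| := by
  have hsub := norm_sub_le (((τ : ℂ) * z) • e (2 * i)) ((1 + 3 * z) • e (2 * i + 1))
  simp only [norm_smul, he.1, norm_mul, hz.norm_eq_one, hz.norm_one_add_three_mul,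
    Complex.norm_real, Real.norm_eq_abs, mul_one] at hsub
  rw [waveBoundary, norm_smul, norm_mul, norm_pow, hz.norm_eq_one, one_pow, Complex.norm_ofNat]
  linarith

theorem abs_mul_sqrt_le_norm_planeWave (he : Orthonormal ℂ e) (hz : ‖z‖ = 1) (n : ℕ) :
    |τ| * √(2 * n) ≤ ‖planeWave e τ z n‖ := by
  set s := Finset.Ico (n ^ 2) (n ^ 2 + 2 * n)
  have hodd : Orthonormal ℂ fun i => e (2 * i + 1) :=
    he.comp _ fun i j (h : 2 * i + 1 = 2 * j + 1) => by lia
  have hcoeff (i : ℕ) (hi : i ∈ s) :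
      inner ℂ (e (2 * i + 1)) (planeWave e τ z n) = z ^ (i + 1) * τ := by
    have hsplit : planeWave e τ z n = ∑ j ∈ s, (z ^ (j + 1) * τ) • e (2 * j + 1) +
        ∑ j ∈ s, (z ^ (j + 1) * (1 + 3 * z)) • e (2 * j + 2) := by
      simp only [planeWave, smul_add, smul_smul, Finset.sum_add_distrib, s]
    rw [hsplit, inner_add_right, hodd.inner_right_sum _ hi, inner_sum,
      Finset.sum_eq_zero fun j _ => ?_, add_zero]
    rw [inner_smul_right, he.2 (by lia), mul_zero]
  have hbessel := hodd.sum_inner_products_le (planeWave e τ z n) (s := s)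
  rw [Finset.sum_congr rfl fun i hi => by rw [hcoeff i hi]] at hbessel
  refine abs_le_of_sq_le_sq' ?_ (norm_nonneg _) |>.2
  simpa [hz, s, mul_pow, mul_comm] using hbessel

namespace IsJacobiSystem

variable {T : H →L[ℂ] H}

theorem apply_planeWave_sub (he : IsJacobiSystem aSeq bSeq T e) (hz : IsBlochPhase τ z) {n : ℕ}
    (hn : 1 ≤ n) : T (planeWave e τ z n) - (beta n + τ) • planeWave e τ z n =
      waveBoundary e τ z (n ^ 2) - waveBoundary e τ z (n ^ 2 + 2 * n) := by
  have hterm : ∀ i ∈ Finset.Ico (n ^ 2) (n ^ 2 + 2 * n),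
      T (z ^ (i + 1) • ((τ : ℂ) • e (2 * i + 1) + (1 + 3 * z) • e (2 * i + 2))) -
        (beta n + τ) • z ^ (i + 1) • ((τ : ℂ) • e (2 * i + 1) + (1 + 3 * z) • e (2 * i + 2)) =
      -(waveBoundary e τ z (i + 1) - waveBoundary e τ z i) := by
    intro i hi
    rw [Finset.mem_Ico] at hi
    have ha₂ : aSeq (2 * i + 2) = 1 := aSeq_two_mul (i + 1)
    have ha₃ : aSeq (2 * i + 3) = 3 := aSeq_two_mul_add_one (i + 1)
    have h₁ : T (e (2 * i + 1)) =
        (3 : ℂ) • e (2 * i) + (beta n : ℂ) • e (2 * i + 1) + e (2 * i + 2) := by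
      rw [he.apply_eq, jacobiAction, aSeq_two_mul_add_one, ha₂,
        bSeq_block hn (by lia) (by lia), one_smul]
      module
    have h₂ : T (e (2 * i + 2)) =
        e (2 * i + 1) + (beta n : ℂ) • e (2 * i + 2) + (3 : ℂ) • e (2 * i + 3) := by
      rw [he.apply_eq, jacobiAction, ha₂, ha₃, bSeq_block hn (by lia) (by lia), one_smul]
      module
    rw [map_smul, map_add, map_smul, map_smul, h₁, h₂, waveBoundary, waveBoundary, mul_add_one 2]
    linear_combination (norm := module) (z ^ i * hz.mul_eq) • e (2 * i + 1)
  rw [planeWave, map_sum, Finset.smul_sum, ← Finset.sum_sub_distrib, Finset.sum_congr rfl hterm,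
    Finset.sum_neg_distrib, Finset.sum_Ico_sub (waveBoundary e τ z) (by lia), neg_sub]

theorem exists_mem_spectrum_abs_sub_mul_sqrt_le [CompleteSpace H]
    (he : IsJacobiSystem aSeq bSeq T e) (hT : IsSelfAdjoint T) (h₂ : 2 ≤ |τ|) (h₄ : |τ| ≤ 4)
    {n : ℕ} (hn : 1 ≤ n) :
    ∃ x ∈ spectrum ℝ T, |x - (beta n + τ)| * √(2 * n) ≤ 12 := by
  obtain ⟨z, hz₁, hzτ⟩ := exists_norm_eq_one_norm_one_add_three_mul_eq h₂ h₄
  have hz : IsBlochPhase τ z := ⟨hz₁, hzτ⟩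
  have hτ : 0 < |τ| := two_pos.trans_le h₂
  have hnorm := abs_mul_sqrt_le_norm_planeWave (τ := τ) he.orthonormal hz₁ n
  have hpos : 0 < ‖planeWave e τ z n‖ := lt_of_lt_of_le (by positivity) hnorm
  obtain ⟨x, hx, hle⟩ :=
    exists_mem_spectrum_abs_sub_mul_norm_le hT (beta n + τ) (norm_pos_iff.1 hpos)
  refine ⟨x, hx, le_of_mul_le_mul_left ?_ hτ⟩
  calc |τ| * (|x - (beta n + τ)| * √(2 * n)) = |x - (beta n + τ)| * (|τ| * √(2 * n)) := by ring
    _ ≤ |x - (beta n + τ)| * ‖planeWave e τ z n‖ := by gcongr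
    _ ≤ ‖waveBoundary e τ z (n ^ 2) - waveBoundary e τ z (n ^ 2 + 2 * n)‖ :=
      hle.trans_eq (by rw [he.apply_planeWave_sub hz hn])
    _ ≤ 6 * |τ| + 6 * |τ| := norm_sub_le_of_le (norm_waveBoundary_le he.orthonormal hz _)
      (norm_waveBoundary_le he.orthonormal hz _)
    _ = |τ| * 12 := by ring

end IsJacobiSystem

end PlaneWave

section Density

theorem dyadicIndex_bounds (n : ℕ) :
    -2 ^ (dyadicIndex n).1 < (dyadicIndex n).2 ∧ (dyadicIndex n).2 < 2 ^ (dyadicIndex n).1 := by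
  induction n with
  | zero => simp [dyadicIndex]
  | succ n ih =>
    have hpow : (0 : ℤ) < 2 ^ ((dyadicIndex n).1 + 1) := by positivity
    rw [dyadicIndex]
    split_ifs <;> dsimp only <;> lia

theorem abs_beta_lt_one (n : ℕ) : |beta n| < 1 := by
  have hj : |(dyadicIndex (n - 1)).2| < 2 ^ (dyadicIndex (n - 1)).1 :=
    abs_lt.2 (dyadicIndex_bounds (n - 1))
  rw [beta, abs_div, abs_of_pos (by positivity : (0 : ℝ) < 2 ^ _), div_lt_one (by positivity)]
  exact_mod_cast hj

theorem dyadicIndex_fst_le (n : ℕ) : (dyadicIndex n).1 ≤ n := by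
  induction n with
  | zero => simp [dyadicIndex]
  | succ n ih =>
    rw [dyadicIndex]
    split_ifs <;> dsimp only <;> lia

theorem dyadicIndex_add {m n i : ℕ} {j : ℤ} (hn : dyadicIndex n = (m, j)) (hi : j + i < 2 ^ m) :
    dyadicIndex (n + i) = (m, j + i) := by
  induction i with
  | zero => simpa using hn
  | succ i ih =>
    rw [← add_assoc, dyadicIndex, ih (by lia)]
    dsimp only
    rw [if_pos (by lia)]
    simp [add_assoc]

theorem exists_dyadicIndex_eq_first (m : ℕ) : ∃ n, dyadicIndex n = (m, 1 - 2 ^ m) := by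
  induction m with
  | zero => exact ⟨0, by simp [dyadicIndex]⟩
  | succ m ih =>
    obtain ⟨n, hn⟩ := ih
    have hpow : (1 : ℤ) ≤ 2 ^ m := one_le_pow₀ one_le_two
    obtain ⟨i, hi⟩ := Int.eq_ofNat_of_zero_le (by lia : (0 : ℤ) ≤ 2 * 2 ^ m - 2)
    refine ⟨n + i + 1, ?_⟩
    rw [dyadicIndex, dyadicIndex_add hn (by lia)]
    dsimp only
    rw [if_neg (by lia)]

theorem exists_dyadicIndex_eq {m : ℕ} {j : ℤ} (hj : |j| < 2 ^ m) :
    ∃ n, m ≤ n ∧ dyadicIndex n = (m, j) := by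
  rw [abs_lt] at hj
  obtain ⟨n, hn⟩ := exists_dyadicIndex_eq_first m
  obtain ⟨i, hi⟩ := Int.eq_ofNat_of_zero_le (by lia : (0 : ℤ) ≤ j - (1 - 2 ^ m))
  have hni : dyadicIndex (n + i) = (m, j) := by
    rw [dyadicIndex_add hn (by lia), ← hi, add_sub_cancel]
  exact ⟨n + i, by simpa [hni] using dyadicIndex_fst_le (n + i), hni⟩

theorem exists_abs_beta_sub_le {y : ℝ} (hy : y ∈ Set.Icc (-1) 1) (m : ℕ) :
    ∃ n, m ≤ n ∧ |beta n - y| ≤ 2 / 2 ^ m := by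
  have hpow : (1 : ℝ) ≤ 2 ^ m := one_le_pow₀ one_le_two
  set j := ⌊y * (2 ^ m - 1)⌋
  have hj₁ : j ≤ y * (2 ^ m - 1) := Int.floor_le _
  have hj₂ : y * (2 ^ m - 1) < j + 1 := Int.lt_floor_add_one _
  have hj : |j| < 2 ^ m := by
    rw [abs_lt]
    constructor
    · rw [← Int.add_one_le_iff, Int.le_floor]
      push_cast
      nlinarith [hy.1]
    · have : (j : ℝ) < 2 ^ m := by nlinarith [hy.2]
      exact_mod_cast this
  obtain ⟨n, hmn, hn⟩ := exists_dyadicIndex_eq hj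
  refine ⟨n + 1, by lia, ?_⟩
  have hsub : (j : ℝ) / 2 ^ m - y = (j - y * 2 ^ m) / 2 ^ m := by field_simp
  rw [beta, Nat.add_sub_cancel, hn, hsub, abs_div, abs_of_pos (by positivity : (0 : ℝ) < 2 ^ m)]
  gcongr
  exact abs_le.2 ⟨by linarith [hy.1, hy.2], by linarith [hy.1, hy.2]⟩

theorem mapClusterPt_beta {y : ℝ} (hy : y ∈ Set.Icc (-1) 1) : MapClusterPt y atTop beta := by
  choose n hmn hn using exists_abs_beta_sub_le hy
  have hzero : Tendsto (fun m : ℕ => (2 : ℝ) / 2 ^ m) atTop (𝓝 0) :=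
    tendsto_const_nhds.div_atTop (tendsto_pow_atTop_atTop_of_one_lt one_lt_two)
  have hlim : Tendsto (beta ∘ n) atTop (𝓝 y) :=
    tendsto_iff_dist_tendsto_zero.2 (squeeze_zero (fun _ => dist_nonneg) hn hzero)
  exact .of_comp (tendsto_atTop_mono hmn tendsto_id) hlim.mapClusterPt

theorem mapClusterPt_of_tendsto_dist {ι X : Type*} [PseudoMetricSpace X] {l : Filter ι}
    {u x : ι → X} {y : X} (hu : MapClusterPt y l u)
    (hux : Tendsto (fun i => dist (u i) (x i)) l (𝓝 0)) : MapClusterPt y l x := by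
  obtain ⟨g, hg, hgu⟩ := mapClusterPt_iff_ultrafilter.1 hu
  exact mapClusterPt_iff_ultrafilter.2 ⟨g, hg, (tendsto_iff_of_dist (hux.mono_left hg)).1 hgu⟩

end Density

namespace IsJacobiSystem

variable {H : Type*} [NormedAddCommGroup H] [InnerProductSpace ℂ H] [CompleteSpace H]
  {T : H →L[ℂ] H} {e : ℕ → H}

theorem add_mem_spectrum (he : IsJacobiSystem aSeq bSeq T e) (hT : IsSelfAdjoint T) {y τ : ℝ}
    (hy : y ∈ Set.Icc (-1) 1) (h₂ : 2 ≤ |τ|) (h₄ : |τ| ≤ 4) : y + τ ∈ spectrum ℝ T := by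
  choose! x hx hdist using fun n hn =>
    he.exists_mem_spectrum_abs_sub_mul_sqrt_le hT h₂ h₄ (n := n) hn
  have hβ : MapClusterPt (y + τ) atTop fun n => beta n + τ :=
    (mapClusterPt_beta hy).continuousAt_comp (f := (· + τ)) (by fun_prop)
  have hzero : Tendsto (fun n : ℕ => 12 / √(2 * n)) atTop (𝓝 0) :=
    tendsto_const_nhds.div_atTop (Real.tendsto_sqrt_atTop.comp
      (tendsto_natCast_atTop_atTop.const_mul_atTop two_pos))
  refine (spectrum.isClosed T).mem_of_mapClusterPt (mapClusterPt_of_tendsto_dist hβ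
    (squeeze_zero' (.of_forall fun _ => dist_nonneg) ?_ hzero)) ((eventually_ge_atTop 1).mono hx)
  filter_upwards [eventually_ge_atTop 1] with n hn
  rw [dist_comm, Real.dist_eq, le_div_iff₀ (by positivity)]
  exact hdist n hn

theorem closure_setOf_eval_jacobiPoly_eq_zero (he : IsJacobiSystem aSeq bSeq T e)
    (hT : IsSelfAdjoint T) :
    closure {x | x ∈ Set.Ioo (-1) 1 ∧ ∃ n, (jacobiPoly aSeq bSeq n).eval x = 0} =
      Set.Icc (-1) 1 := by
  refine (closure_minimal (fun x hx => Set.Ioo_subset_Icc_self hx.1) isClosed_Icc).antisymm ?_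
  rw [← closure_Ioo (by norm_num : (-1 : ℝ) ≠ 1)]
  refine closure_minimal (fun y hy => ?_) isClosed_closure
  choose! x hdist hx using fun n hn =>
    he.exists_eval_jacobiPoly_eq_zero_near_beta hT (n := n) hn
  have hzero : Tendsto (fun n : ℕ => ((3 : ℝ) ^ (2 * n))⁻¹) atTop (𝓝 0) :=
    tendsto_inv_atTop_zero.comp ((tendsto_pow_atTop_atTop_of_one_lt (by norm_num)).comp
      (tendsto_id.const_mul_atTop' two_pos))
  have hcluster : MapClusterPt y atTop x := by
    refine mapClusterPt_of_tendsto_dist (mapClusterPt_beta (Set.Ioo_subset_Icc_self hy))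
      (squeeze_zero' (.of_forall fun _ => dist_nonneg) ?_ hzero)
    filter_upwards [eventually_ge_atTop 1] with n hn
    rw [dist_comm]
    exact hdist n hn
  refine mem_closure_iff_nhds.2 fun t ht => ?_
  obtain ⟨n, ⟨hnt, hn₁⟩, hn⟩ := ((hcluster.frequently
    (inter_mem ht (isOpen_Ioo.mem_nhds hy))).and_eventually (eventually_ge_atTop 1)).exists
  exact ⟨x n, hnt, hn₁, _, hx n hn⟩

end IsJacobiSystem

section SequenceSpace

/-- The standard basis of `ℓ²`. -/
noncomputable def stdBasis (ι 𝕜 : Type*) [RCLike 𝕜] :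
    HilbertBasis ι 𝕜 (lp (fun _ : ι => 𝕜) 2) :=
  .ofRepr (.refl 𝕜 _)

variable {ι 𝕜 : Type*} [RCLike 𝕜]

theorem inner_stdBasis (i : ι) (u : lp (fun _ : ι => 𝕜) 2) :
    inner 𝕜 (stdBasis ι 𝕜 i) u = u i :=
  ((stdBasis ι 𝕜).repr_apply_apply u i).symm

theorem stdBasis_apply [DecidableEq ι] (i k : ι) :
    stdBasis ι 𝕜 i k = if k = i then 1 else 0 := by
  rw [← inner_stdBasis, orthonormal_iff_ite.1 (stdBasis ι 𝕜).orthonormal]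

theorem dense_span_stdBasis :
    Dense (Submodule.span 𝕜 (Set.range (stdBasis ι 𝕜)) : Set (lp (fun _ : ι => 𝕜) 2)) :=
  Submodule.dense_iff_topologicalClosure_eq_top.2 (stdBasis ι 𝕜).dense_span

/-- The isometry `u ↦ u ∘ σ` of `ℓ²`, for a permutation `σ` of the index set. -/
noncomputable def permuteCoords (σ : Equiv.Perm ι) :
    lp (fun _ : ι => 𝕜) 2 →L[𝕜] lp (fun _ : ι => 𝕜) 2 :=
  (HilbertBasis.mk ((stdBasis ι 𝕜).orthonormal.comp σ σ.injective)
    (by rw [σ.surjective.range_comp, (stdBasis ι 𝕜).dense_span])).repr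

theorem permuteCoords_apply (σ : Equiv.Perm ι) (u : lp (fun _ : ι => 𝕜) 2) (i : ι) :
    permuteCoords σ u i = u (σ i) := by
  refine (HilbertBasis.repr_apply_apply _ u i).trans ?_
  rw [HilbertBasis.coe_mk, Function.comp_apply, inner_stdBasis]

theorem permuteCoords_permuteCoords {σ : Equiv.Perm ι} (hσ : Function.Involutive σ)
    (u : lp (fun _ : ι => 𝕜) 2) : permuteCoords σ (permuteCoords σ u) = u := by
  ext i
  rw [permuteCoords_apply, permuteCoords_apply, hσ i]

theorem isSelfAdjoint_permuteCoords {σ : Equiv.Perm ι} (hσ : Function.Involutive σ) :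
    IsSelfAdjoint (permuteCoords (𝕜 := 𝕜) σ) := by
  rw [ContinuousLinearMap.isSelfAdjoint_iff_isSymmetric]
  intro u v
  calc inner 𝕜 (permuteCoords σ u) v
      = inner 𝕜 (permuteCoords σ u) (permuteCoords σ (permuteCoords σ v)) := by
        rw [permuteCoords_permuteCoords hσ]
    _ = inner 𝕜 u (permuteCoords σ v) := LinearIsometryEquiv.inner_map_map _ u _

theorem norm_permuteCoords_le (σ : Equiv.Perm ι) : ‖permuteCoords (𝕜 := 𝕜) σ‖ ≤ 1 :=
  ContinuousLinearMap.opNorm_le_bound _ zero_le_one fun u => by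
    rw [one_mul]
    exact (LinearIsometryEquiv.norm_map _ u).le

/-- The operator on `ℓ²` that multiplies coordinate `i` by the real number `w i`. -/
noncomputable def diagonalOp {K : ℝ} (hK : 0 ≤ K) (w : ι → ℝ) (hw : ∀ i, |w i| ≤ K) :
    lp (fun _ : ι => 𝕜) 2 →L[𝕜] lp (fun _ : ι => 𝕜) 2 :=
  lp.mapCLM 2 (fun i => (w i : 𝕜) • ContinuousLinearMap.id 𝕜 𝕜) hK
    (fun i => by simpa [norm_smul] using hw i)

variable {K : ℝ} (hK : 0 ≤ K) (w : ι → ℝ) (hw : ∀ i, |w i| ≤ K)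

theorem diagonalOp_apply (u : lp (fun _ : ι => 𝕜) 2) (i : ι) :
    diagonalOp hK w hw u i = w i * u i := by
  simp [diagonalOp]

theorem norm_diagonalOp_le : ‖diagonalOp (𝕜 := 𝕜) hK w hw‖ ≤ K :=
  lp.norm_mapCLM_le ..

theorem isSelfAdjoint_diagonalOp : IsSelfAdjoint (diagonalOp (𝕜 := 𝕜) hK w hw) := by
  rw [ContinuousLinearMap.isSelfAdjoint_iff_isSymmetric]
  intro u v
  simp [lp.inner_eq_tsum, diagonalOp_apply, mul_assoc, mul_left_comm]

end SequenceSpace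

theorem inv_norm_inv_le_of_mem_spectrum_add {𝕜 A : Type*} [NormedField 𝕜] [NormedRing A]
    [NormedAlgebra 𝕜 A] [NormOneClass A] [HasSummableGeomSeries A] (u : Aˣ) (t : A) {x : 𝕜}
    (hx : x ∈ spectrum 𝕜 (u + t)) : ‖(↑u⁻¹ : A)‖⁻¹ ≤ ‖t‖ + ‖x‖ := by
  by_contra! h
  refine hx ?_
  have hlt : ‖t - algebraMap 𝕜 A x‖ < ‖(↑u⁻¹ : A)‖⁻¹ :=
    (norm_sub_le _ _).trans_lt (by rwa [norm_algebraMap'])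
  have hunit : IsUnit (u + (t - algebraMap 𝕜 A x)) := ⟨u.add _ hlt, rfl⟩
  rw [← add_sub_assoc] at hunit
  exact IsUnit.sub_iff.1 hunit

theorem abs_bSeq_le_one (k : ℕ) : |bSeq k| ≤ 1 := by
  rw [bSeq]
  split_ifs <;> exact (abs_beta_lt_one _).le

/-- The involution of `ℕ` exchanging `2 j` and `2 j + 1`. -/
def swapEven : Equiv.Perm ℕ :=
  Function.Involutive.toPerm (fun k => if k % 2 = 0 then k + 1 else k - 1) fun k => by grind

/-- The involution of `ℕ` fixing `0` and exchanging `2 j + 1` and `2 j + 2`. -/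
def swapOdd : Equiv.Perm ℕ :=
  Function.Involutive.toPerm (fun k => if k = 0 then 0 else if k % 2 = 0 then k - 1 else k + 1)
    fun k => by grind

theorem involutive_swapEven : Function.Involutive swapEven :=
  swapEven.left_inv

theorem involutive_swapOdd : Function.Involutive swapOdd :=
  swapOdd.left_inv

theorem swapEven_apply (k : ℕ) : swapEven k = if k % 2 = 0 then k + 1 else k - 1 := rfl

theorem swapOdd_apply (k : ℕ) :
    swapOdd k = if k = 0 then 0 else if k % 2 = 0 then k - 1 else k + 1 := rfl

instance : Nontrivial EllTwo :=
  ⟨stdBasis ℕ ℂ 0, 0, (stdBasis ℕ ℂ).orthonormal.ne_zero 0⟩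

/-- The part of the Jacobi matrix with entries `a₁, a₃, …`, divided by their common value `3`. -/
noncomputable def strongBonds : EllTwo →L[ℂ] EllTwo :=
  permuteCoords swapEven

/-- The part of the Jacobi matrix with entries `a₂, a₄, …` and `b₁, b₂, …`. As `swapOdd` fixes `0`,
its permutation operator has a diagonal entry `1` there, which the diagonal summand cancels. -/
noncomputable def weakPart : EllTwo →L[ℂ] EllTwo :=
  permuteCoords swapOdd +
    diagonalOp zero_le_one (fun k => if k = 0 then -1 else bSeq (k + 1)) fun k => by
      split_ifs
      · rw [abs_neg, abs_one]
      · exact abs_bSeq_le_one _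

/-- The operator on `ℓ²` whose Jacobi parameters are `aSeq` and `bSeq`. -/
noncomputable def jacobiOp : EllTwo →L[ℂ] EllTwo :=
  (3 : ℂ) • strongBonds + weakPart

theorem jacobiOp_apply (u : EllTwo) (k : ℕ) :
    jacobiOp u k = 3 * u (swapEven k) +
      (u (swapOdd k) + ((if k = 0 then -1 else bSeq (k + 1) : ℝ) : ℂ) * u k) := by
  simp only [jacobiOp, strongBonds, weakPart, add_apply, smul_apply, lp.coeFn_add, lp.coeFn_smul,
    Pi.add_apply, Pi.smul_apply, permuteCoords_apply, diagonalOp_apply, smul_eq_mul]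
  rfl

theorem isJacobiOperator_jacobiOp : IsJacobiOperator aSeq bSeq jacobiOp := by
  have hb₁ : bSeq 1 = 0 := by simp [bSeq_one, beta, dyadicIndex]
  refine fun u => ⟨?_, fun k => ?_⟩
  · rw [jacobiOp_apply, hb₁, show aSeq 1 = 3 from aSeq_two_mul_add_one 0]
    simp only [swapEven_apply, swapOdd_apply]
    norm_num
  · rw [jacobiOp_apply, if_neg k.succ_ne_zero]
    obtain ⟨j, rfl | rfl⟩ := Nat.even_or_odd' k
    · have hEven : swapEven (2 * j + 1) = 2 * j := by grind [swapEven_apply]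
      have hOdd : swapOdd (2 * j + 1) = 2 * j + 2 := by grind [swapOdd_apply]
      rw [hEven, hOdd, aSeq_two_mul_add_one, show 2 * j + 2 = 2 * (j + 1) by ring, aSeq_two_mul]
      push_cast
      ring_nf
    · have hEven : swapEven (2 * j + 1 + 1) = 2 * (j + 1) + 1 := by grind [swapEven_apply]
      have hOdd : swapOdd (2 * j + 1 + 1) = 2 * j + 1 := by grind [swapOdd_apply]
      rw [hEven, hOdd, show 2 * j + 1 + 2 = 2 * (j + 1) + 1 by ring, aSeq_two_mul_add_one,
        show 2 * j + 1 + 1 = 2 * (j + 1) by ring, aSeq_two_mul]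
      push_cast
      ring_nf

theorem isSelfAdjoint_jacobiOp : IsSelfAdjoint jacobiOp :=
  (IsSelfAdjoint.smul (r := (3 : ℂ)) (Complex.conj_ofNat 3)
    (isSelfAdjoint_permuteCoords involutive_swapEven)).add
    ((isSelfAdjoint_permuteCoords involutive_swapOdd).add (isSelfAdjoint_diagonalOp ..))

theorem strongBonds_mul_self : strongBonds * strongBonds = 1 :=
  ContinuousLinearMap.ext (permuteCoords_permuteCoords involutive_swapEven)

theorem norm_weakPart_le : ‖weakPart‖ ≤ 2 :=
  (norm_add_le_of_le (norm_permuteCoords_le _) (norm_diagonalOp_le ..)).trans (by norm_num)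

theorem norm_smul_strongBonds_le (c : ℂ) : ‖c • strongBonds‖ ≤ ‖c‖ :=
  (norm_smul c strongBonds).trans_le
    (mul_le_of_le_one_right (norm_nonneg c) (norm_permuteCoords_le _))

theorem norm_jacobiOp_le : ‖jacobiOp‖ ≤ 5 :=
  (norm_add_le_of_le (norm_smul_strongBonds_le 3) norm_weakPart_le).trans (by norm_num)

theorem one_le_abs_of_mem_spectrum_jacobiOp {x : ℝ} (hx : x ∈ spectrum ℝ jacobiOp) :
    1 ≤ |x| := by
  let U : (EllTwo →L[ℂ] EllTwo)ˣ :=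
    ⟨(3 : ℂ) • strongBonds, (3 : ℂ)⁻¹ • strongBonds, by simp [strongBonds_mul_self],
      by simp [strongBonds_mul_self]⟩
  have hU : (3 : ℝ) ≤ ‖(↑U⁻¹ : EllTwo →L[ℂ] EllTwo)‖⁻¹ := by
    refine (le_inv_comm₀ three_pos (Units.norm_pos _)).2 ?_
    exact (norm_smul_strongBonds_le _).trans (by norm_num)
  have := inv_norm_inv_le_of_mem_spectrum_add U weakPart hx
  rw [Real.norm_eq_abs] at this
  linarith [norm_weakPart_le]

theorem IsJacobiOperator.apply_eq_jacobiAction {a b : ℕ → ℝ} {L : EllTwo →L[ℂ] EllTwo}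
    (hL : IsJacobiOperator a b L) (u : EllTwo) (m : ℕ) :
    L u m = jacobiAction a b (fun k => u k) m := by
  cases m <;> simp [jacobiAction, (hL u).1, (hL u).2]

theorem IsJacobiOperator.isJacobiSystem {a b : ℕ → ℝ} {L : EllTwo →L[ℂ] EllTwo}
    (hL : IsJacobiOperator a b L) : IsJacobiSystem a b L (stdBasis ℕ ℂ) where
  orthonormal := (stdBasis ℕ ℂ).orthonormal
  apply_eq n := by
    ext m
    let coord : EllTwo →ₗ[ℝ] ℂ :=
      { toFun u := u m
        map_add' _ _ := rfl
        map_smul' _ _ := rfl }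
    calc L (stdBasis ℕ ℂ n) m
        = jacobiAction a b (fun k => if k = n then (1 : ℂ) else 0) m := by
          simp only [hL.apply_eq_jacobiAction, stdBasis_apply]
      _ = jacobiAction a b (fun k => stdBasis ℕ ℂ k m) n := by
          rw [jacobiAction_ite_comm]
          simp only [stdBasis_apply, eq_comm]
      _ = jacobiAction a b (stdBasis ℕ ℂ) n m := (map_jacobiAction coord a b (stdBasis ℕ ℂ) n).symm

theorem stdBasis_zero : stdBasis ℕ ℂ 0 = firstVec := by
  ext k
  rw [stdBasis_apply, firstVec, lp.single_apply, Pi.single_apply]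

theorem spectrum_jacobiOp : spectrum ℝ jacobiOp = Set.Icc (-5) (-1) ∪ Set.Icc 1 5 := by
  have he := isJacobiOperator_jacobiOp.isJacobiSystem
  refine Set.Subset.antisymm (fun x hx => ?_) (Set.union_subset ?_ ?_)
  · have h₅ : |x| ≤ 5 := (spectrum.norm_le_norm_of_mem hx).trans norm_jacobiOp_le
    exact (le_abs'.1 (one_le_abs_of_mem_spectrum_jacobiOp hx)).imp
      (fun h => ⟨(abs_le.1 h₅).1, h⟩) fun h => ⟨h, (abs_le.1 h₅).2⟩
  · rintro x ⟨h₁, h₂⟩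
    have hx := he.add_mem_spectrum isSelfAdjoint_jacobiOp (y := (x + 3) / 2) (τ := (x - 3) / 2)
      ⟨by linarith, by linarith⟩ (le_abs'.2 (.inl (by linarith)))
      (abs_le.2 ⟨by linarith, by linarith⟩)
    rwa [show (x + 3) / 2 + (x - 3) / 2 = x by ring] at hx
  · rintro x ⟨h₁, h₂⟩
    have hx := he.add_mem_spectrum isSelfAdjoint_jacobiOp (y := (x - 3) / 2) (τ := (x + 3) / 2)
      ⟨by linarith, by linarith⟩ (le_abs'.2 (.inr (by linarith)))
      (abs_le.2 ⟨by linarith, by linarith⟩)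
    rwa [show (x - 3) / 2 + (x + 3) / 2 = x by ring] at hx

end GapExample

theorem mainTheorem3 :
    ∃ L : GapExample.EllTwo →L[ℂ] GapExample.EllTwo,
      GapExample.IsJacobiOperator GapExample.aSeq GapExample.bSeq L ∧
      (∃ μ : Measure ℝ, GapExample.IsSpectralMeasure L GapExample.firstVec μ) ∧
      ∀ μ : Measure ℝ, GapExample.IsSpectralMeasure L GapExample.firstVec μ →
        μ.support = Set.Icc (-5 : ℝ) (-1) ∪ Set.Icc (1 : ℝ) 5 ∧
        (∃ p : ℕ → ℝ[X], GapExample.IsOrthonormalPolynomials μ p) ∧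
        ∀ p : ℕ → ℝ[X], GapExample.IsOrthonormalPolynomials μ p →
          GapExample.HasRecursion GapExample.aSeq GapExample.bSeq p ∧
          (∀ n : ℕ, 1 ≤ n → ∃ x : ℝ,
            |x - GapExample.beta n| ≤ 2 * ((3 : ℝ) ^ (2 * n))⁻¹ ∧
              (p (2 * (n + 1) ^ 2 - 1)).eval x = 0) ∧
          closure {x : ℝ | x ∈ Set.Ioo (-1 : ℝ) 1 ∧ ∃ n : ℕ, (p n).eval x = 0} =
            Set.Icc (-1 : ℝ) 1 := by
  rw [← GapExample.stdBasis_zero]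
  have hT := GapExample.isSelfAdjoint_jacobiOp
  have hL := GapExample.isJacobiOperator_jacobiOp
  have he := hL.isJacobiSystem
  have ha (n : ℕ) : 0 < GapExample.aSeq (n + 1) := GapExample.aSeq_pos (n + 1)
  refine ⟨_, hL, GapExample.exists_isSpectralMeasure hT _, fun μ hμ => ?_⟩
  have hJ : GapExample.IsOrthonormalPolynomials μ _ := he.isOrthonormalPolynomials ha hμ
  have hcyclic : GapExample.IsCyclicVector GapExample.jacobiOp (GapExample.stdBasis ℕ ℂ 0) :=
    he.isCyclicVector (fun n => (ha n).ne') GapExample.dense_span_stdBasis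
  have hsupp := (hμ.support_eq_spectrum hcyclic).trans GapExample.spectrum_jacobiOp
  refine ⟨hsupp, ⟨_, hJ⟩, fun p hp => ?_⟩
  obtain rfl := hp.eq hJ
  refine ⟨GapExample.jacobiPoly_hasRecursion fun n => (ha n).ne', fun n hn => ?_,
    he.closure_setOf_eval_jacobiPoly_eq_zero hT⟩
  obtain ⟨x, hx, hx₀⟩ := he.exists_eval_jacobiPoly_eq_zero_near_beta hT hn
  exact ⟨x, hx.trans (le_mul_of_one_le_left (by positivity) one_le_two), hx₀⟩
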